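/- Let $q$ be a prime power and consider linear rank-metric codes $C\subseteq\mathbb F_q^{m\times n}$ with the rank distance $d(A,B)=\operatorname{rk}(A-B)$; let $d_{\min}$ denote minimum distance. For $1\le i\le mn$ the $i$-th code distance of $C$ is $$\alpha_i(C)=\begin{cases}\max\{d_{\min}(D): D\subseteq C,\ \dim D=i\}, & i\le\dim C,\\ \max\{d_{\min}(D): D\supseteq C,\ \dim D=i\}, & i\ge\dim C.\end{cases}$$ The $q$-polymatroids associated with $C$ are the one on $\mathbb F_q^n$ with rank function $\rho(J)=\frac1m\bigl(\dim C-\dim\{M\in C:\operatorname{rowsp}(M)\subseteq J^\perp\}\bigr)$ and the one on $\mathbb F_q^m$ with rank function $\rho(J)=\frac1n\bigl(\dim C-\dim\{M\in C:\operatorname{colsp}(M)\subseteq J^\perp\}\bigr)$; they are $q$-matroids if their rank functions are integer-valued. The uniform $q$-matroid of rank $k$ on $\mathbb F_q^n$ has rank function $J\mapsto\min\{\dim J,k\}$. For $n\le m$, a nonzero code $C$ with $m\mid\dim C$ is MRD if $d_{\min}(C)=n-\frac{\dim C}{m}+1$. For $1\le k\le n\le m$, a Gabidulin code is the $\mathbb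 F_{q^m}$-linear code in $\mathbb F_{q^m}^n$ generated by the vectors $(a_1^{q^i},\dots,a_n^{q^i})$, $0\le i<k$, where $a_1,\dots,a_n\in\mathbb F_{q^m}$ are linearly independent over $\mathbb F_q$, written as a code in $\mathbb F_q^{m\times n}$ by replacing each entry by its column of coordinates in some $\mathbb F_q$-basis of $\mathbb F_{q^m}$. **Theorem.** The sequence of code distances $(\alpha_1(C),\dots,\alpha_{mn}(C))$ is not an invariant of the $q$-polymatroids associated with a rank-metric code, nor of the associated $q$-matroids when the $q$-polymatroids are $q$-matroids. Already for $q=2$, $m=n=4$ there are codes whose associated $q$-polymatroids coincide and are $q$-matroids, but whose sequences of code distances differ. Explicitly, let $C_1\subseteq\mathbb F_2^{4\times4}$ be the span of $$\begin{pmatrix}1&0&0&0\\0&0&0&1\\0&0&1&0\\0&1&0&0\end{pmatrix},\ \begin{pmatrix}0&1&0&0\\0&0&1&1\\0&0&0&1\\1&1&0&0\end{pmatrix},\ \begin{pmatrix}0&0&1&0\\0&1&1&1\\1&0&1&0\\1&0&0&1\end{pmatrix},\ \begin{pmatrix}0&0&0&1\\1&1&1&0\\0&1&0&1\\0&1&1&1\end{pmatrix}.$$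 Then $C_1$ is an MRD code of dimension $4$ and minimum distance $4$, with $\alpha_5(C_1)=2$, and both of its associated $q$-polymatroids are the uniform $q$-matroid of rank $1$ on $\mathbb F_2^4$. There is a Gabidulin code in $\mathbb F_2^{4\times4}$ with the same dimension and minimum distance as $C_1$, and every such Gabidulin code $C_2$ is MRD, has $\alpha_i(C_2)=3$ for $5\le i\le8$, and has both of its associated $q$-polymatroids equal to the uniform $q$-matroid of rank $1$ on $\mathbb F_2^4$. -/

import Mathlib

namespace RankMetric

open Module

universe u

/-! ### Codes, minimum distance, code distances -/

/-- A (linear) rank-metric code: an `F`-linear subspace of the space of `m × n` matrices over `F`. -/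
abbrev Code (F : Type u) [Field F] (m n : ℕ) : Type u :=
  Submodule F (Matrix (Fin m) (Fin n) F)

section Distances

variable {F : Type u} [Field F] {m n : ℕ}

/-- The rank distance `d(A, B) = rk (A - B)`. -/
noncomputable def rankDist (A B : Matrix (Fin m) (Fin n) F) : ℕ :=
  (A - B).rank

/-- The minimum distance of a (nonzero) code. -/
noncomputable def minDist (C : Code F m n) : ℕ :=
  sInf {w : ℕ | ∃ A ∈ C, ∃ B ∈ C, A ≠ B ∧ rankDist A B = w}

/-- The `i`-th code distance `α_i(C)`, for `1 ≤ i ≤ m * n`: the largest minimum distance of an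
`i`-dimensional subcode of `C` if `i ≤ dim C`, and of an `i`-dimensional supercode of `C`
if `i ≥ dim C` (for `i = dim C` the two agree, both being the minimum distance of `C`). -/
noncomputable def codeDistance (C : Code F m n) (i : ℕ) : ℕ :=
  if i ≤ finrank F C then
    sSup {δ : ℕ | ∃ D : Code F m n, D ≤ C ∧ finrank F D = i ∧ minDist D = δ}
  else
    sSup {δ : ℕ | ∃ D : Code F m n, C ≤ D ∧ finrank F D = i ∧ minDist D = δ}

/-- The sequence of code distances `(α_1(C), …, α_{mn}(C))`. -/
noncomputable def codeDistances (C : Code F m n) : Fin (m * n) → ℕ :=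
  fun i => codeDistance C (i.val + 1)

/-- Maximum rank distance codes in `F^{m × n}`, `n ≤ m`: nonzero codes whose dimension is
divisible by `m` and which meet the Singleton bound `d_min(C) ≤ n - dim C / m + 1`. -/
def IsMRD (C : Code F m n) : Prop :=
  n ≤ m ∧ C ≠ ⊥ ∧ m ∣ finrank F C ∧ minDist C = n - finrank F C / m + 1

end Distances

/-! ### Gabidulin codes -/

section Gabidulin

variable {F : Type u} [Field F] {m n : ℕ}

/-- The `L`-linear code in `L^n` generated by the `k × n` matrix with entries `a_j ^ (q ^ i)`,
`0 ≤ i < k`, where `q = |F|`. -/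
noncomputable def gabidulinVectorCode (F : Type u) [Field F] {L : Type u} [Field L]
    (a : Fin n → L) (k : ℕ) : Submodule L (Fin n → L) :=
  Submodule.span L (Set.range fun (i : Fin k) (j : Fin n) => a j ^ (Nat.card F ^ (i : ℕ)))

/-- Expanding each entry of a vector of `L^n` into its column of coordinates with respect to an
`F`-basis of `L`. -/
noncomputable def expand {L : Type u} [Field L] [Algebra F L] (b : Basis (Fin m) F L) :
    (Fin n → L) →ₗ[F] Matrix (Fin m) (Fin n) F where
  toFun v := Matrix.of fun i j => b.repr (v j) i
  map_add' v w := by ext i j; simp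
  map_smul' c v := by ext i j; simp

/-- `C` is (the matrix form of) a Gabidulin code of length `n` and `L`-dimension `k` for some
extension field `L` of `F` of degree `m`. -/
def IsGabidulin (C : Code F m n) : Prop :=
  ∃ (L : Type u) (_ : Field L) (_ : Algebra F L) (b : Basis (Fin m) F L) (a : Fin n → L) (k : ℕ),
    LinearIndependent F a ∧ 1 ≤ k ∧ k ≤ n ∧ n ≤ m ∧
      C = ((gabidulinVectorCode F a k).restrictScalars F).map (expand b)

end Gabidulin

/-! ### q-polymatroids and q-matroids -/

/-- A `q`-polymatroid on `F^n` (with `q = |F|`). -/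
@[ext]
structure QPolymatroid (F : Type u) [Field F] (n : ℕ) where
  rank : Submodule F (Fin n → F) → ℝ
  rank_nonneg : ∀ J, 0 ≤ rank J
  rank_le : ∀ J, rank J ≤ finrank F J
  rank_mono : ∀ J K, J ≤ K → rank J ≤ rank K
  rank_submodular : ∀ J K, rank (J ⊔ K) + rank (J ⊓ K) ≤ rank J + rank K

/-- A `q`-matroid is a `q`-polymatroid with an integer-valued rank function. -/
def QPolymatroid.IsQMatroid {F : Type u} [Field F] {n : ℕ} (P : QPolymatroid F n) : Prop :=
  ∀ J, ∃ r : ℤ, P.rank J = r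

/-- The uniform `q`-matroid of rank `min k n` on `F^n`: `J ↦ min (dim J) k`. -/
noncomputable def uniformQMatroid (F : Type u) [Field F] (n k : ℕ) : QPolymatroid F n where
  rank J := ((min (finrank F J) k : ℕ) : ℝ)
  rank_nonneg J := Nat.cast_nonneg _
  rank_le J := by exact_mod_cast min_le_left _ _
  rank_mono J K h := by
    have := Submodule.finrank_mono h
    exact_mod_cast min_le_min_right k this
  rank_submodular J K := by
    have h := Submodule.finrank_sup_add_finrank_inf_eq J K
    have h1 := Submodule.finrank_mono (inf_le_left : J ⊓ K ≤ J)
    have h2 := Submodule.finrank_mono (inf_le_right : J ⊓ K ≤ K)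
    have h3 : min (finrank F ↥(J ⊔ K)) k + min (finrank F ↥(J ⊓ K)) k
        ≤ min (finrank F J) k + min (finrank F K) k := by omega
    exact_mod_cast h3

section Associated

variable {F : Type u} [Field F] {m n : ℕ}

/-- The orthogonal complement `J^⊥` with respect to the standard dot product on `F^n`. -/
def orth (J : Submodule F (Fin n → F)) : Submodule F (Fin n → F) where
  carrier := {v | ∀ w ∈ J, dotProduct v w = 0}
  zero_mem' := by intro w _; simp
  add_mem' := by
    intro v v' hv hv' w hw
    rw [add_dotProduct, hv w hw, hv' w hw, add_zero]
  smul_mem' := by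
    intro c v hv w hw
    rw [smul_dotProduct, hv w hw, smul_zero]

/-- The row space of a matrix. -/
def rowSpace (M : Matrix (Fin m) (Fin n) F) : Submodule F (Fin n → F) :=
  Submodule.span F (Set.range M.row)

lemma rowSpace_le_iff (M : Matrix (Fin m) (Fin n) F) (K : Submodule F (Fin n → F)) :
    rowSpace M ≤ K ↔ ∀ i, M.row i ∈ K := by
  rw [rowSpace, Submodule.span_le, Set.range_subset_iff]
  rfl

/-- The subcode `C(K)` of the codewords whose row space is contained in `K`. -/
def shortened (C : Code F m n) (K : Submodule F (Fin n → F)) : Code F m n where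
  carrier := {M | M ∈ C ∧ rowSpace M ≤ K}
  zero_mem' := ⟨C.zero_mem, (rowSpace_le_iff _ _).2 fun _ => K.zero_mem⟩
  add_mem' := by
    rintro A B ⟨hA, hA'⟩ ⟨hB, hB'⟩
    rw [rowSpace_le_iff] at hA' hB'
    exact ⟨C.add_mem hA hB, (rowSpace_le_iff _ _).2 fun i => K.add_mem (hA' i) (hB' i)⟩
  smul_mem' := by
    rintro c A ⟨hA, hA'⟩
    rw [rowSpace_le_iff] at hA'
    exact ⟨C.smul_mem c hA, (rowSpace_le_iff _ _).2 fun i => K.smul_mem c (hA' i)⟩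

lemma mem_shortened {C : Code F m n} {K : Submodule F (Fin n → F)}
    {M : Matrix (Fin m) (Fin n) F} : M ∈ shortened C K ↔ M ∈ C ∧ rowSpace M ≤ K :=
  Iff.rfl

lemma orth_anti {J K : Submodule F (Fin n → F)} (h : J ≤ K) : orth K ≤ orth J :=
  fun _ hv w hw => hv w (h hw)

lemma orth_inf_orth_le (J K : Submodule F (Fin n → F)) : orth J ⊓ orth K ≤ orth (J ⊔ K) := by
  rintro v ⟨hJ, hK⟩ w hw
  obtain ⟨x, hx, y, hy, rfl⟩ := Submodule.mem_sup.1 hw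
  rw [dotProduct_add, hJ x hx, hK y hy, add_zero]

lemma shortened_le (C : Code F m n) (K : Submodule F (Fin n → F)) : shortened C K ≤ C :=
  fun _ h => h.1

lemma shortened_mono (C : Code F m n) {J K : Submodule F (Fin n → F)} (h : J ≤ K) :
    shortened C J ≤ shortened C K :=
  fun _ hM => ⟨hM.1, hM.2.trans h⟩

lemma shortened_submodular (C : Code F m n) (J K : Submodule F (Fin n → F)) :
    finrank F (shortened C (orth J)) + finrank F (shortened C (orth K)) ≤
      finrank F (shortened C (orth (J ⊔ K))) + finrank F (shortened C (orth (J ⊓ K))) := by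
  rw [← Submodule.finrank_sup_add_finrank_inf_eq, add_comm]
  refine add_le_add (Submodule.finrank_mono ?_) (Submodule.finrank_mono ?_)
  · rintro M ⟨h1, h2⟩
    exact ⟨h1.1, (le_inf h1.2 h2.2).trans (orth_inf_orth_le J K)⟩
  · exact sup_le (shortened_mono C (orth_anti inf_le_left))
      (shortened_mono C (orth_anti inf_le_right))

lemma finrank_le_shortened (C : Code F m n) (J : Submodule F (Fin n → F)) :
    finrank F C ≤ finrank F (shortened C (orth J)) + m * finrank F J := by
  let φ : C →ₗ[F] (J →ₗ[F] (Fin m → F)) :=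
    { toFun := fun M => (Matrix.mulVecLin M.1).comp J.subtype
      map_add' := by intro A B; ext v; simp
      map_smul' := by intro c A; ext v; simp }
  have h1 := LinearMap.finrank_range_add_finrank_ker φ
  have h2 : finrank F (LinearMap.range φ) ≤ m * finrank F J := by
    refine (Submodule.finrank_le _).trans ?_
    rw [Module.finrank_linearMap, Module.finrank_fin_fun, mul_comm]
  have h3 : finrank F (LinearMap.ker φ) ≤ finrank F (shortened C (orth J)) := by
    have hle : (LinearMap.ker φ).map C.subtype ≤ shortened C (orth J) := by
      rintro _ ⟨M, hM, rfl⟩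
      refine ⟨M.2, (rowSpace_le_iff _ _).2 fun i w hw => ?_⟩
      have := congrFun (LinearMap.congr_fun (LinearMap.mem_ker.1 hM) ⟨w, hw⟩) i
      exact this
    have := Submodule.finrank_mono hle
    rwa [Submodule.finrank_map_subtype_eq] at this
  omega

/-- The `q`-polymatroid on `F^n` associated with a code `C ≤ F^{m × n}` through row spaces:
`ρ(J) = (dim C - dim C(J^⊥)) / m`. -/
noncomputable def rowQPolymatroid (C : Code F m n) : QPolymatroid F n where
  rank J := ((finrank F C : ℝ) - finrank F (shortened C (orth J))) / m
  rank_nonneg J := by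
    have h : (finrank F (shortened C (orth J)) : ℝ) ≤ finrank F C := by
      exact_mod_cast Submodule.finrank_mono (shortened_le C _)
    exact div_nonneg (by linarith) (Nat.cast_nonneg _)
  rank_le J := by
    have h : (finrank F C : ℝ) ≤ finrank F (shortened C (orth J)) + m * finrank F J := by
      exact_mod_cast finrank_le_shortened C J
    refine div_le_of_le_mul₀ (Nat.cast_nonneg _) (Nat.cast_nonneg _) ?_
    linarith
  rank_mono J K h := by
    have h : (finrank F (shortened C (orth K)) : ℝ) ≤ finrank F (shortened C (orth J)) := by
      exact_mod_cast Submodule.finrank_mono (shortened_mono C (orth_anti h))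
    exact div_le_div_of_nonneg_right (by linarith) (Nat.cast_nonneg _)
  rank_submodular J K := by
    have h : (finrank F (shortened C (orth J)) : ℝ) + finrank F (shortened C (orth K)) ≤
        finrank F (shortened C (orth (J ⊔ K))) + finrank F (shortened C (orth (J ⊓ K))) := by
      exact_mod_cast shortened_submodular C J K
    rw [← add_div, ← add_div]
    exact div_le_div_of_nonneg_right (by linarith) (Nat.cast_nonneg _)

/-- The transposed code. -/
def transposeCode (C : Code F m n) : Code F n m :=
  C.map (Matrix.transposeLinearEquiv (Fin m) (Fin n) F F).toLinearMap

/-- The `q`-polymatroid on `F^m` associated with a code `C ≤ F^{m × n}` through column spaces: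
`ρ(J) = (dim C - dim {M ∈ C | colspace M ≤ J^⊥}) / n`. -/
noncomputable def colQPolymatroid (C : Code F m n) : QPolymatroid F m :=
  rowQPolymatroid (transposeCode C)

/-- A function of codes in `F^{m × n}` is an invariant of the associated `q`-polymatroids if it
takes the same value on codes with the same row and the same column `q`-polymatroid. -/
def IsQPolymatroidInvariant {β : Type*} (φ : Code F m n → β) : Prop :=
  ∀ C D : Code F m n, rowQPolymatroid C = rowQPolymatroid D →
    colQPolymatroid C = colQPolymatroid D → φ C = φ D

/-- A function of codes in `F^{m × n}` is an invariant of the associated `q`-matroid if it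
takes the same value on codes whose associated `q`-polymatroids are `q`-matroids
and coincide. -/
def IsQMatroidInvariant {β : Type*} (φ : Code F m n → β) : Prop :=
  ∀ C D : Code F m n, (rowQPolymatroid C).IsQMatroid → (colQPolymatroid C).IsQMatroid →
    rowQPolymatroid C = rowQPolymatroid D →
    colQPolymatroid C = colQPolymatroid D → φ C = φ D

end Associated

/-! ### The explicit code -/

/-- The Byrne–Ravagnani code in `𝔽₂^{4 × 4}`. -/
def byrneRavagnaniCode : Code (ZMod 2) 4 4 :=
  Submodule.span (ZMod 2)
    {!![1, 0, 0, 0; 0, 0, 0, 1; 0, 0, 1, 0; 0, 1, 0, 0],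
     !![0, 1, 0, 0; 0, 0, 1, 1; 0, 0, 0, 1; 1, 1, 0, 0],
     !![0, 0, 1, 0; 0, 1, 1, 1; 1, 0, 1, 0; 1, 0, 0, 1],
     !![0, 0, 0, 1; 1, 1, 1, 0; 0, 1, 0, 1; 0, 1, 1, 1]}

end RankMetric

/-!
The polymatroids of a code record, for each `J`, the dimension of the space of codewords
annihilating `J`. In a `4`-dimensional code of `4 × 4` matrices all of whose nonzero elements are
invertible, only `0` annihilates a nonzero `J`, so both polymatroids are uniform of rank one
(`rowQPolymatroid_eq_uniform`, `colQPolymatroid_eq_uniform`). The Byrne–Ravagnani code and every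
`4`-dimensional Gabidulin code are of this kind, and the fifth code distance separates them.

A Gabidulin code of `L`-dimension `k` consists of the restrictions to `n` independent points of the
`q`-polynomials `∑ i < k, c i * u ^ q ^ i`. A nonzero one has at most `q ^ (k - 1)` roots, hence
rank at least `n - k + 1` (`lt_rank_expand_add`). Raising `k` by one enlarges the code by `m`
dimensions and lowers the minimum distance by one only, so the codes in between, together with the
Singleton bound `minDist_add_le`, give the code distances (`codeDistance_gabidulinCode`): these are
`3` for `k = 1`, `n = m = 4` and `5 ≤ i ≤ 8`.

A `5`-dimensional code containing the Byrne–Ravagnani code is generated by it and one further matrix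
`A`, so its minimum distance is bounded by the least rank in the coset of `A`. The bilinear product
`(x, t) ↦ x ᵥ* brWord t` has no zero divisors, so for each `x ≠ 0` exactly one codeword agrees with
`A` on the row vector `x`. If the same codeword belongs to two distinct `x` and `y`, its difference
with `A` has a left kernel of dimension at least two, hence rank at most two. That such a repetition
among the `15` nonzero vectors always occurs is a finite check over the `2 ^ 12` cosets, each
represented by a matrix with first row zero (`hasRepetition_brDiv`, `exists_rank_sub_le_two`). The
coset of `brExtra` contains no matrix of rank one, so the fifth code distance is exactly `2`.
-/

namespace RankMetric

open Module

universe u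

/-! ### Rank, minimum distance and intermediate codes -/

section General

variable {F : Type*} [Field F]

lemma exists_finrank_eq_of_le {V : Type*} [AddCommGroup V] [Module F V] [FiniteDimensional F V]
    {U W : Submodule F V} (hUW : U ≤ W) {i : ℕ} (hU : finrank F U ≤ i) (hW : i ≤ finrank F W) :
    ∃ D : Submodule F V, U ≤ D ∧ D ≤ W ∧ finrank F D = i := by
  induction i, hU using Nat.le_induction with
  | base => exact ⟨U, le_rfl, hUW, rfl⟩
  | succ i hi ih =>
    obtain ⟨D, hUD, hDW, hD⟩ := ih (by omega)
    have hlt : D < W := lt_of_le_of_ne hDW (by rintro rfl; omega)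
    obtain ⟨x, hxW, hxD⟩ := SetLike.exists_of_lt hlt
    refine ⟨D ⊔ Submodule.span F {x}, hUD.trans le_sup_left, sup_le hDW ?_, ?_⟩
    · rwa [Submodule.span_singleton_le_iff_mem]
    · rw [Submodule.finrank_sup_span_singleton hxD, hD]

variable {m n : ℕ}

lemma rank_add_finrank_ker (M : Matrix (Fin m) (Fin n) F) :
    M.rank + finrank F (LinearMap.ker M.mulVecLin) = n := by
  have h := LinearMap.finrank_range_add_finrank_ker M.mulVecLin
  rwa [Module.finrank_fin_fun] at h

lemma mulVec_eq_zero_of_rank_eq {M : Matrix (Fin m) (Fin n) F} (hM : M.rank = n)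
    {w : Fin n → F} (hw : M.mulVec w = 0) : w = 0 := by
  have h := rank_add_finrank_ker M
  have hker : LinearMap.ker M.mulVecLin = ⊥ := Submodule.finrank_eq_zero.1 (by omega)
  have : w ∈ LinearMap.ker M.mulVecLin := hw
  rwa [hker, Submodule.mem_bot] at this

lemma rank_add_two_le {M : Matrix (Fin m) (Fin n) F} {x y : Fin m → F}
    (hxy : LinearIndependent F ![x, y]) (hx : Matrix.vecMul x M = 0)
    (hy : Matrix.vecMul y M = 0) : M.rank + 2 ≤ m := by
  have h := rank_add_finrank_ker M.transpose
  rw [Matrix.rank_transpose] at h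
  have hle : Submodule.span F (Set.range ![x, y]) ≤ LinearMap.ker M.transpose.mulVecLin := by
    rw [Submodule.span_le, Set.range_subset_iff]
    intro i
    fin_cases i <;> simpa
  have h2 := Submodule.finrank_mono hle
  rw [finrank_span_eq_card hxy, Fintype.card_fin] at h2
  omega

lemma two_le_rank {M : Matrix (Fin m) (Fin n) F} {x y : Fin m → F}
    (hxy : LinearIndependent F ![Matrix.vecMul x M, Matrix.vecMul y M]) : 2 ≤ M.rank := by
  rw [← Matrix.rank_transpose]
  have hle : Submodule.span F (Set.range ![Matrix.vecMul x M, Matrix.vecMul y M]) ≤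
      LinearMap.range M.transpose.mulVecLin := by
    rw [Submodule.span_le, Set.range_subset_iff]
    intro i
    fin_cases i
    · exact ⟨x, by simp⟩
    · exact ⟨y, by simp⟩
  have h2 := Submodule.finrank_mono hle
  rwa [finrank_span_eq_card hxy, Fintype.card_fin] at h2

lemma minDist_le_rank {C : Code F m n} {M : Matrix (Fin m) (Fin n) F} (hM : M ∈ C) (h0 : M ≠ 0) :
    minDist C ≤ M.rank :=
  Nat.sInf_le ⟨M, hM, 0, C.zero_mem, h0, by rw [rankDist, sub_zero]⟩

/-- The zero code is excluded because `minDist ⊥ = sInf ∅ = 0`. -/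
lemma le_minDist {C : Code F m n} (hC : C ≠ ⊥) {d : ℕ}
    (h : ∀ M ∈ C, M ≠ 0 → d ≤ M.rank) : d ≤ minDist C := by
  obtain ⟨M, hM, h0⟩ := Submodule.exists_mem_ne_zero_of_ne_bot hC
  refine le_csInf ⟨_, M, hM, 0, C.zero_mem, h0, rfl⟩ ?_
  rintro _ ⟨A, hA, B, hB, hAB, rfl⟩
  exact h _ (C.sub_mem hA hB) (sub_ne_zero.2 hAB)

lemma rowSpace_le_orth_iff {M : Matrix (Fin m) (Fin n) F} {J : Submodule F (Fin n → F)} :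
    rowSpace M ≤ orth J ↔ ∀ w ∈ J, M.mulVec w = 0 := by
  rw [rowSpace_le_iff]
  exact ⟨fun h w hw => funext fun i => h i w hw, fun h i w hw => congrFun (h w hw) i⟩

lemma ne_bot_of_finrank_pos {C : Code F m n} (h : 0 < finrank F C) : C ≠ ⊥ := by
  rintro rfl
  rw [finrank_bot] at h
  omega

/-- The Singleton bound: a code of dimension more than `m * k` contains, for each `k`-dimensional
`J`, a nonzero matrix annihilating `J`. -/
lemma minDist_add_le {C : Code F m n} {k : ℕ} (hk : k ≤ n) (hC : m * k < finrank F C) :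
    minDist C + k ≤ n := by
  obtain ⟨J, -, -, hJ⟩ := exists_finrank_eq_of_le (F := F) (V := Fin n → F) (U := ⊥) (W := ⊤)
    (i := k) bot_le (by simp) (by simpa)
  have h := finrank_le_shortened C J
  rw [hJ] at h
  obtain ⟨M, hM, h0⟩ := Submodule.exists_mem_ne_zero_of_ne_bot
    (ne_bot_of_finrank_pos (show 0 < finrank F (shortened C (orth J)) by omega))
  have hle : J ≤ LinearMap.ker M.mulVecLin := rowSpace_le_orth_iff.1 hM.2
  have h1 := Submodule.finrank_mono hle
  have h2 := rank_add_finrank_ker M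
  have h3 := minDist_le_rank hM.1 h0
  omega

/-! ### The polymatroids of an `n`-dimensional code of invertible matrices -/

/-- An invertible matrix annihilates no nonzero `J`, so `C(J^⊥) = 0` unless `J = 0`. -/
lemma rowQPolymatroid_eq_uniform {C : Code F n n} (hn : 0 < n) (hC : finrank F C = n)
    (hrank : ∀ M ∈ C, M ≠ 0 → M.rank = n) : rowQPolymatroid C = uniformQMatroid F n 1 := by
  have hn' : (n : ℝ) ≠ 0 := Nat.cast_ne_zero.2 hn.ne'
  refine QPolymatroid.ext (funext fun J => ?_)
  change ((finrank F C : ℝ) - finrank F (shortened C (orth J))) / n =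
    ((min (finrank F J) 1 : ℕ) : ℝ)
  by_cases hJ : J = ⊥
  · have h : shortened C (orth J) = C := by
      refine le_antisymm (shortened_le _ _) fun M hM => ⟨hM, rowSpace_le_orth_iff.2 ?_⟩
      rintro w hw
      rw [hJ, Submodule.mem_bot] at hw
      rw [hw, Matrix.mulVec_zero]
    rw [h, hJ, finrank_bot]
    simp
  · have h : shortened C (orth J) = ⊥ := by
      refine (Submodule.eq_bot_iff _).2 fun M hM => by_contra fun h0 => hJ ?_
      exact (Submodule.eq_bot_iff _).2 fun w hw =>
        mulVec_eq_zero_of_rank_eq (hrank M hM.1 h0) (rowSpace_le_orth_iff.1 hM.2 w hw)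
    have h1 : 1 ≤ finrank F J := Submodule.one_le_finrank_iff.2 hJ
    rw [h, finrank_bot, hC, min_eq_right h1]
    simp [hn']

lemma finrank_transposeCode (C : Code F m n) : finrank F (transposeCode C) = finrank F C :=
  LinearEquiv.finrank_map_eq _ _

lemma colQPolymatroid_eq_uniform {C : Code F n n} (hn : 0 < n) (hC : finrank F C = n)
    (hrank : ∀ M ∈ C, M ≠ 0 → M.rank = n) : colQPolymatroid C = uniformQMatroid F n 1 := by
  refine rowQPolymatroid_eq_uniform hn ((finrank_transposeCode C).trans hC) ?_
  rintro _ ⟨M, hM, rfl⟩ h0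
  change M.transpose.rank = n
  rw [Matrix.rank_transpose]
  refine hrank M hM ?_
  rintro rfl
  exact h0 (map_zero _)

lemma rank_eq_of_minDist_eq {C : Code F m n} (hd : minDist C = n) {M : Matrix (Fin m) (Fin n) F}
    (hM : M ∈ C) (h0 : M ≠ 0) : M.rank = n :=
  le_antisymm (by simpa using M.rank_le_width) (hd.symm.le.trans (minDist_le_rank hM h0))

lemma isMRD_of_minDist_eq {C : Code F n n} (hn : 0 < n) (hC : finrank F C = n)
    (hd : minDist C = n) : IsMRD C := by
  refine ⟨le_rfl, ne_bot_of_finrank_pos (by omega), by rw [hC], ?_⟩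
  rw [hC, hd, Nat.div_self hn]
  omega

lemma isQMatroid_uniform (k : ℕ) : (uniformQMatroid F n k).IsQMatroid :=
  fun J => ⟨(min (finrank F J) k : ℕ), by simp [uniformQMatroid]⟩

end General

/-! ### Gabidulin codes -/

section GabidulinLemmas

variable {F : Type u} [Field F] {L : Type u} [Field L] [Algebra F L]

/-- The `q`-polynomial `u ↦ ∑ i, c i * u ^ q ^ i` with `q = |F|`, as an `F`-linear map. -/
noncomputable def qPolyMap (F : Type*) [Field F] [Finite F] {L : Type*} [Field L] [Algebra F L]
    {k : ℕ} (c : Fin k → L) : L →ₗ[F] L :=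
  letI := Fintype.ofFinite F
  ∑ i, LinearMap.mulLeft F (c i) ∘ₗ (FiniteField.frobeniusAlgHom F L ^ (i : ℕ)).toLinearMap

lemma qPolyMap_apply [Finite F] {k : ℕ} (c : Fin k → L) (u : L) :
    qPolyMap F c u = ∑ i : Fin k, c i * u ^ Nat.card F ^ (i : ℕ) := by
  let := Fintype.ofFinite F
  simp only [qPolyMap, LinearMap.sum_apply, LinearMap.comp_apply, LinearMap.mulLeft_apply,
    AlgHom.toLinearMap_apply, AlgHom.coe_pow, FiniteField.coe_frobeniusAlgHom, pow_iterate]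
  simp only [Nat.card_eq_fintype_card]

/-- A nonzero `q`-polynomial with `k` coefficients has degree at most `q ^ (k - 1)`, hence at most
that many roots. -/
lemma finrank_ker_qPolyMap_lt [Finite F] [FiniteDimensional F L] {k : ℕ} {c : Fin k → L}
    (hc : c ≠ 0) :
    finrank F (LinearMap.ker (qPolyMap F c)) < k := by
  classical
  have : Finite L := Module.finite_of_finite F
  let := Fintype.ofFinite L
  obtain ⟨i₀, hi₀⟩ := Function.ne_iff.1 hc
  have hk : 0 < k := i₀.pos
  have hq : 1 < Nat.card F := Finite.one_lt_card
  set p : Polynomial L := ∑ i : Fin k, Polynomial.monomial (Nat.card F ^ (i : ℕ)) (c i) with hp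
  have hcoeff : p.coeff (Nat.card F ^ (i₀ : ℕ)) = c i₀ := by
    rw [hp, Polynomial.finsetSum_coeff, Finset.sum_eq_single i₀]
    · simp
    · intro j _ hj
      rw [Polynomial.coeff_monomial, if_neg]
      exact fun h => hj (Fin.ext (Nat.pow_right_injective hq h))
    · simp
  have hp0 : p ≠ 0 := by
    rintro h
    rw [h, Polynomial.coeff_zero] at hcoeff
    exact hi₀ hcoeff.symm
  have hdeg : p.natDegree ≤ Nat.card F ^ (k - 1) := by
    refine Polynomial.natDegree_sum_le_of_forall_le _ _ fun i _ => ?_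
    exact (Polynomial.natDegree_monomial_le _).trans
      (Nat.pow_le_pow_right hq.le (by have := i.2; omega))
  have hcard : Nat.card (LinearMap.ker (qPolyMap F c)) ≤ Nat.card F ^ (k - 1) := by
    have h1 : ((LinearMap.ker (qPolyMap F c) : Set L).toFinset).card ≤ p.natDegree := by
      refine Polynomial.card_le_degree_of_subset_roots fun u hu => ?_
      have hu' : qPolyMap F c u = 0 := by simpa using hu
      rw [Polynomial.mem_roots hp0, Polynomial.IsRoot, hp, Polynomial.eval_finsetSum]
      simpa [qPolyMap_apply] using hu'
    rw [← Set.ncard_eq_toFinset_card'] at h1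
    exact (show Nat.card (LinearMap.ker (qPolyMap F c)) ≤ _ from h1).trans hdeg
  rw [Module.natCard_eq_pow_finrank (K := F)] at hcard
  have := (Nat.pow_le_pow_iff_right hq).1 hcard
  omega

variable {m n : ℕ}

/-- The matrix form of the Gabidulin code of `L`-dimension `k` with evaluation points `a`. -/
noncomputable def gabidulinCode {F : Type u} [Field F] {L : Type u} [Field L] [Algebra F L]
    (b : Basis (Fin m) F L) (a : Fin n → L) (k : ℕ) : Code F m n :=
  ((gabidulinVectorCode F a k).restrictScalars F).map (expand b)

lemma expand_mulVec (b : Basis (Fin m) F L) (v : Fin n → L) (x : Fin n → F) (i : Fin m) :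
    (expand b v).mulVec x i = b.repr (∑ j, x j • v j) i := by
  simp [Matrix.mulVec, dotProduct, expand, mul_comm]

/-- The word with coefficients `c` is the restriction of the `q`-polynomial `c` to the span of the
points `a j`, so the kernel of its matrix embeds into the kernel of the `q`-polynomial. -/
lemma lt_rank_expand_add [Finite F] (b : Basis (Fin m) F L) {a : Fin n → L}
    (ha : LinearIndependent F a) {k : ℕ} {c : Fin k → L} (hc : c ≠ 0) :
    n < (expand b (∑ i, c i • fun j => a j ^ Nat.card F ^ (i : ℕ))).rank + k := by
  have : FiniteDimensional F L := b.finiteDimensional_of_finite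
  set v : Fin n → L := ∑ i, c i • fun j => a j ^ Nat.card F ^ (i : ℕ) with hv
  have hvj : ∀ j, v j = qPolyMap F c (a j) := fun j => by
    rw [hv, qPolyMap_apply, Finset.sum_apply]
    rfl
  have hle : (LinearMap.ker (expand b v).mulVecLin).map (Fintype.linearCombination F a) ≤
      LinearMap.ker (qPolyMap F c) := by
    rintro _ ⟨x, hx, rfl⟩
    have h0 : b.repr (∑ j, x j • v j) = 0 := Finsupp.ext fun i => by
      rw [← expand_mulVec]
      exact congrFun (LinearMap.mem_ker.1 hx) i
    rw [LinearMap.mem_ker, Fintype.linearCombination_apply, map_sum]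
    simp only [map_smul, ← hvj]
    exact b.repr.map_eq_zero_iff.1 h0
  have hinj : Function.Injective (Fintype.linearCombination F a) :=
    ha.fintypeLinearCombination_injective
  have h1 := Submodule.finrank_mono hle
  rw [← (Submodule.equivMapOfInjective _ hinj _).finrank_eq] at h1
  have h2 := finrank_ker_qPolyMap_lt (F := F) hc
  have h3 := rank_add_finrank_ker (expand b v)
  omega

lemma lt_rank_add_of_mem_gabidulinCode [Finite F] (b : Basis (Fin m) F L) {a : Fin n → L}
    (ha : LinearIndependent F a) {k : ℕ} {M : Matrix (Fin m) (Fin n) F}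
    (hM : M ∈ gabidulinCode b a k) (h0 : M ≠ 0) : n < M.rank + k := by
  obtain ⟨v, hv, rfl⟩ := hM
  obtain ⟨c, rfl⟩ := (Submodule.mem_span_range_iff_exists_fun L).1 hv
  refine lt_rank_expand_add b ha ?_
  rintro rfl
  exact h0 (by simp)

lemma finrank_gabidulinCode [Finite F] (b : Basis (Fin m) F L) {a : Fin n → L}
    (ha : LinearIndependent F a) {k : ℕ} (hk : k ≤ n) :
    finrank F (gabidulinCode b a k) = m * k := by
  have hinj : Function.Injective (expand (n := n) b) := by
    intro v w h
    funext j
    exact b.repr.injective (Finsupp.ext fun i => congrFun (congrFun h i) j)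
  have hli : LinearIndependent L fun (i : Fin k) (j : Fin n) => a j ^ Nat.card F ^ (i : ℕ) := by
    rw [Fintype.linearIndependent_iff]
    intro c hc
    by_contra hne
    have h := lt_rank_expand_add b ha (c := c) (fun h => hne fun i => congrFun h i)
    rw [hc, map_zero, Matrix.rank_zero] at h
    omega
  rw [gabidulinCode, ← (Submodule.equivMapOfInjective _ hinj _).finrank_eq]
  have h1 : finrank L (gabidulinVectorCode F a k) = k := by
    rw [gabidulinVectorCode, finrank_span_eq_card hli, Fintype.card_fin]
  have h2 : finrank F L = m := by rw [finrank_eq_card_basis b, Fintype.card_fin]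
  have h3 := Module.finrank_mul_finrank F L (gabidulinVectorCode F a k)
  rw [h1, h2] at h3
  exact h3.symm

lemma gabidulinCode_mono (b : Basis (Fin m) F L) (a : Fin n → L) {k l : ℕ} (h : k ≤ l) :
    gabidulinCode b a k ≤ gabidulinCode b a l := by
  have hle : gabidulinVectorCode F a k ≤ gabidulinVectorCode F a l := by
    rw [gabidulinVectorCode, Submodule.span_le, Set.range_subset_iff]
    exact fun i => Submodule.subset_span ⟨Fin.castLE h i, rfl⟩
  exact Submodule.map_mono hle

lemma minDist_gabidulinCode [Finite F] (b : Basis (Fin m) F L) {a : Fin n → L}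
    (ha : LinearIndependent F a) (hm : 0 < m) {k : ℕ} (hk : k < n) :
    minDist (gabidulinCode b a (k + 1)) = n - k := by
  have hdim := finrank_gabidulinCode b ha (show k + 1 ≤ n from hk)
  have hlt : m * k < m * (k + 1) := Nat.mul_lt_mul_of_pos_left (Nat.lt_succ_self k) hm
  refine le_antisymm ?_ (le_minDist (ne_bot_of_finrank_pos (by omega)) fun M hM h0 => ?_)
  · have := minDist_add_le hk.le (show m * k < finrank F (gabidulinCode b a (k + 1)) by omega)
    omega
  · have := lt_rank_add_of_mem_gabidulinCode b ha hM h0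
    omega

/-- Any code between two consecutive Gabidulin codes has at least the minimum distance of the
larger one, and this is optimal by the Singleton bound. -/
lemma codeDistance_gabidulinCode [Finite F] (b : Basis (Fin m) F L) {a : Fin n → L}
    (ha : LinearIndependent F a) {k : ℕ} (hk : k < n) {i : ℕ} (hi : m * k < i)
    (hi' : i ≤ m * (k + 1)) : codeDistance (gabidulinCode b a k) i = n - k := by
  have hdim := finrank_gabidulinCode b ha hk.le
  have hdim' := finrank_gabidulinCode b ha (show k + 1 ≤ n from hk)
  rw [codeDistance, if_neg (by omega)]
  have hupper : ∀ D : Code F m n, finrank F D = i → minDist D ≤ n - k := fun D hD => by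
    have := minDist_add_le hk.le (show m * k < finrank F D by omega)
    omega
  refine IsGreatest.csSup_eq ⟨?_, ?_⟩
  · obtain ⟨D, hD, hD', hDi⟩ := exists_finrank_eq_of_le
      (gabidulinCode_mono b a (Nat.le_add_right k 1)) (i := i) (by omega) (by omega)
    refine ⟨D, hD, hDi, le_antisymm (hupper D hDi) ?_⟩
    refine le_minDist (ne_bot_of_finrank_pos (by omega)) fun M hM h0 => ?_
    have := lt_rank_add_of_mem_gabidulinCode b ha (hD' hM) h0
    omega
  · rintro _ ⟨D, -, hDi, rfl⟩
    exact hupper D hDi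

end GabidulinLemmas

/-! ### The Byrne–Ravagnani code -/

/-- The four matrices spanning the code. -/
def brGen : Fin 4 → Matrix (Fin 4) (Fin 4) (ZMod 2) :=
  ![!![1, 0, 0, 0; 0, 0, 0, 1; 0, 0, 1, 0; 0, 1, 0, 0],
    !![0, 1, 0, 0; 0, 0, 1, 1; 0, 0, 0, 1; 1, 1, 0, 0],
    !![0, 0, 1, 0; 0, 1, 1, 1; 1, 0, 1, 0; 1, 0, 0, 1],
    !![0, 0, 0, 1; 1, 1, 1, 0; 0, 1, 0, 1; 0, 1, 1, 1]]

/-- The codeword with coefficient vector `t`, with its entries written out; its first row is `t`. -/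
def brWord (t : Fin 4 → ZMod 2) : Matrix (Fin 4) (Fin 4) (ZMod 2) :=
  !![t 0, t 1, t 2, t 3;
     t 3, t 2 + t 3, t 1 + t 2 + t 3, t 0 + t 1 + t 2;
     t 2, t 3, t 0 + t 2, t 1 + t 3;
     t 1 + t 2, t 0 + t 1 + t 3, t 3, t 2 + t 3]

lemma brWord_eq (t : Fin 4 → ZMod 2) : brWord t = ∑ k, t k • brGen k := by
  revert t
  decide +kernel

lemma mem_byrneRavagnaniCode {M : Matrix (Fin 4) (Fin 4) (ZMod 2)} :
    M ∈ byrneRavagnaniCode ↔ ∃ t, brWord t = M := by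
  have h : byrneRavagnaniCode = Submodule.span (ZMod 2) (Set.range brGen) := by
    rw [byrneRavagnaniCode]
    simp only [brGen, Matrix.range_cons, Matrix.range_empty, Set.union_empty, Set.singleton_union]
  simp only [h, Submodule.mem_span_range_iff_exists_fun, brWord_eq]

lemma linearIndependent_pair_zmod_two {V : Type*} [AddCommGroup V] [Module (ZMod 2) V] {x y : V}
    (hx : x ≠ 0) (hy : y ≠ 0) (hxy : x ≠ y) : LinearIndependent (ZMod 2) ![x, y] := by
  have h2 : ∀ s : ZMod 2, s = 0 ∨ s = 1 := by decide
  rw [LinearIndependent.pair_iff]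
  intro s t h
  rcases h2 s with rfl | rfl <;> rcases h2 t with rfl | rfl
  · exact ⟨rfl, rfl⟩
  · simp [hy] at h
  · simp [hx] at h
  · rw [one_smul, one_smul] at h
    refine absurd ?_ hxy
    rw [eq_neg_of_add_eq_zero_left h, ← neg_one_smul (ZMod 2) y, ZMod.neg_eq_self_mod_two, one_smul]

/-- The vector of `𝔽₂⁴` whose coordinates are the binary digits of `x`. -/
def bitVec (x : ℕ) : Fin 4 → ZMod 2 := fun i => if x.testBit i then 1 else 0

lemma bitVec_xor (x y : ℕ) : bitVec (x ^^^ y) = bitVec x + bitVec y := by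
  funext i
  simp only [bitVec, Nat.testBit_xor, Pi.add_apply]
  cases x.testBit i <;> cases y.testBit i <;> decide

lemma exists_bitVec_eq : ∀ v : Fin 4 → ZMod 2, ∃ x < 16, bitVec x = v := by
  decide +kernel

lemma bitVec_injOn : ∀ x < 16, ∀ y < 16, bitVec x = bitVec y → x = y := by
  decide +kernel

/-- Division for the product `(x, t) ↦ x ᵥ* brWord t`: if `0 < x < 16`, the digits of `brDiv x w`
are the coefficients of the codeword sending the row vector `x` to `w`. The `x`-th entry lists the
values for `w = 15, …, 0` as hexadecimal digits. -/
def brDiv (x w : ℕ) : ℕ :=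
  [0x0, 0xfedcba9876543210, 0x94f2a7c185e3b6d0, 0x827de41b39c65fa0,
   0xc963d872eb41fa50, 0x37bf62ea9d15c840, 0x6f814da35cb27e90, 0x4b1e3c69d287a5f0,
   0xb8a95647cfde2130, 0x7546cefda89b1320, 0x2c5bf1864a3d97e0, 0xe62a19d5b37f4c80,
   0xad3425bc61f8e970, 0x53e89f2417acdb60, 0xd1957b3f2e6a84c0, 0x1ac7835ef4296db0].getD x 0
    >>> (4 * w) % 16

lemma bitVec_vecMul_brWord :
    ∀ x < 16, x ≠ 0 → ∀ w < 16,
      Matrix.vecMul (bitVec x) (brWord (bitVec (brDiv x w))) = bitVec w := by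
  decide +kernel

lemma vecMul_brWord_eq_zero :
    ∀ x t : Fin 4 → ZMod 2, Matrix.vecMul x (brWord t) = 0 → x = 0 ∨ t = 0 := by
  decide +kernel

/-- The combination, with coefficients the digits of `x`, of the rows `0, a, b, c`. -/
def rowComb (a b c x : ℕ) : ℕ :=
  (if x.testBit 1 then a else 0) ^^^ ((if x.testBit 2 then b else 0) ^^^
    (if x.testBit 3 then c else 0))

lemma bitVec_rowComb (a b c x : ℕ) :
    bitVec (rowComb a b c x) =
      Matrix.vecMul (bitVec x) (Matrix.of ![0, bitVec a, bitVec b, bitVec c]) := by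
  have h : ∀ (p : Bool) (y : ℕ),
      bitVec (if p then y else 0) = (if p then (1 : ZMod 2) else 0) • bitVec y := by
    rintro (_ | _) y
    · funext i; simp [bitVec]
    · simp
  rw [rowComb, bitVec_xor, bitVec_xor, h, h, h]
  funext j
  simp [Matrix.vecMul, dotProduct, Fin.sum_univ_four, bitVec, add_assoc, ite_apply]

lemma rowComb_lt {a b c : ℕ} (ha : a < 16) (hb : b < 16) (hc : c < 16) (x : ℕ) :
    rowComb a b c x < 16 := by
  have h : ∀ (p : Bool) {y : ℕ}, y < 2 ^ 4 → (if p then y else 0) < 2 ^ 4 := by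
    rintro (_ | _) y hy
    · simp
    · simpa using hy
  exact Nat.xor_lt_two_pow (n := 4) (h _ ha) (Nat.xor_lt_two_pow (h _ hb) (h _ hc))

/-- Whether one of `f n, …, f 1` lies in the set of binary digits of `s` or occurs twice. -/
def hasRepetition (f : ℕ → ℕ) : ℕ → ℕ → Bool
  | 0, _ => false
  | n + 1, s => s.testBit (f (n + 1)) || hasRepetition f n (s ||| 1 <<< f (n + 1))

lemma exists_of_hasRepetition (f : ℕ → ℕ) (n : ℕ) :
    ∀ s, hasRepetition f n s = true →
      (∃ x ≤ n, x ≠ 0 ∧ s.testBit (f x) = true) ∨ ∃ x ≤ n, ∃ y < x, y ≠ 0 ∧ f x = f y := by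
  induction n with
  | zero => intro s h; simp [hasRepetition] at h
  | succ n ih =>
    intro s h
    rw [hasRepetition, Bool.or_eq_true] at h
    rcases h with h | h
    · exact Or.inl ⟨n + 1, le_rfl, n.succ_ne_zero, h⟩
    · rcases ih _ h with ⟨x, hx, hx0, hs⟩ | ⟨x, hx, y, hy⟩
      · rw [Nat.testBit_or, Bool.or_eq_true, Nat.one_shiftLeft, Nat.testBit_two_pow] at hs
        rcases hs with hs | hs
        · exact Or.inl ⟨x, by omega, hx0, hs⟩
        · exact Or.inr ⟨n + 1, le_rfl, x, by omega, hx0, of_decide_eq_true hs⟩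
      · exact Or.inr ⟨x, by omega, y, hy⟩

lemma hasRepetition_brDiv :
    ∀ a < 16, ∀ b < 16, ∀ c < 16,
      hasRepetition (fun x => brDiv x (rowComb a b c x)) 15 0 = true := by
  decide +kernel

/-- For every `A` with rows `0, a, b, c`, the map sending `x ≠ 0` to the codeword that agrees with
`A` on `x` is not injective. -/
lemma exists_brDiv_eq {a b c : ℕ} (ha : a < 16) (hb : b < 16) (hc : c < 16) :
    ∃ x < 16, ∃ y < x, y ≠ 0 ∧ brDiv x (rowComb a b c x) = brDiv y (rowComb a b c y) := by
  rcases exists_of_hasRepetition _ _ _ (hasRepetition_brDiv a ha b hb c hc) with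
    ⟨x, -, -, hx⟩ | ⟨x, hx, h⟩
  · simp at hx
  · exact ⟨x, by omega, h⟩

lemma finrank_byrneRavagnaniCode : finrank (ZMod 2) byrneRavagnaniCode = 4 := by
  let f : (Fin 4 → ZMod 2) →ₗ[ZMod 2] Matrix (Fin 4) (Fin 4) (ZMod 2) :=
    Fintype.linearCombination (ZMod 2) brGen
  have hf : ∀ t, f t = brWord t := fun t => by
    rw [brWord_eq, Fintype.linearCombination_apply]
  have hrange : LinearMap.range f = byrneRavagnaniCode := by
    ext M
    simp only [LinearMap.mem_range, hf, mem_byrneRavagnaniCode]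
  have hinj : Function.Injective f := fun s t h => by
    rw [hf, hf] at h
    funext j
    have := congrFun (congrFun h 0) j
    fin_cases j <;> exact this
  rw [← hrange, LinearMap.finrank_range_of_inj hinj, Module.finrank_fin_fun]

lemma rank_of_mem_byrneRavagnaniCode {M : Matrix (Fin 4) (Fin 4) (ZMod 2)}
    (hM : M ∈ byrneRavagnaniCode) (h0 : M ≠ 0) : M.rank = 4 := by
  obtain ⟨t, rfl⟩ := mem_byrneRavagnaniCode.1 hM
  have h := rank_add_finrank_ker (brWord t).transpose
  have hker : LinearMap.ker (brWord t).transpose.mulVecLin = ⊥ := by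
    refine (Submodule.eq_bot_iff _).2 fun x hx => ?_
    rw [LinearMap.mem_ker, Matrix.mulVecLin_apply, Matrix.mulVec_transpose] at hx
    refine (vecMul_brWord_eq_zero x t hx).resolve_right ?_
    rintro rfl
    exact h0 (by rw [brWord_eq]; simp)
  rwa [hker, finrank_bot, Matrix.rank_transpose, add_zero] at h

lemma minDist_byrneRavagnaniCode : minDist byrneRavagnaniCode = 4 := by
  have hne : byrneRavagnaniCode ≠ ⊥ :=
    ne_bot_of_finrank_pos (by rw [finrank_byrneRavagnaniCode]; norm_num)
  obtain ⟨M, hM, h0⟩ := Submodule.exists_mem_ne_zero_of_ne_bot hne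
  refine le_antisymm ?_ (le_minDist hne fun N hN h => (rank_of_mem_byrneRavagnaniCode hN h).ge)
  exact (minDist_le_rank hM h0).trans (rank_of_mem_byrneRavagnaniCode hM h0).le

/-- The covering radius of the code is at most `2`. Subtracting a codeword makes the first row of
`A` zero; two row vectors `x ≠ y` on which `A` agrees with the same codeword then span a plane in
the left kernel of the difference. -/
lemma exists_rank_sub_le_two (A : Matrix (Fin 4) (Fin 4) (ZMod 2)) :
    ∃ M ∈ byrneRavagnaniCode, (A - M).rank ≤ 2 := by
  set B := A - brWord (A 0) with hB
  obtain ⟨a, ha, ha'⟩ := exists_bitVec_eq (B 1)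
  obtain ⟨b, hb, hb'⟩ := exists_bitVec_eq (B 2)
  obtain ⟨c, hc, hc'⟩ := exists_bitVec_eq (B 3)
  have hB' : B = Matrix.of ![0, bitVec a, bitVec b, bitVec c] := by
    rw [ha', hb', hc']
    ext i j
    fin_cases i
    · fin_cases j <;> simp [hB, brWord]
    all_goals rfl
  obtain ⟨x, hx, y, hyx, hy0, hxy⟩ := exists_brDiv_eq ha hb hc
  have hker : ∀ z < 16, z ≠ 0 →
      brDiv z (rowComb a b c z) = brDiv x (rowComb a b c x) →
      Matrix.vecMul (bitVec z) (B - brWord (bitVec (brDiv x (rowComb a b c x)))) = 0 := by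
    intro z hz hz0 h
    rw [Matrix.vecMul_sub, ← h, bitVec_vecMul_brWord z hz hz0 _ (rowComb_lt ha hb hc z), hB',
      ← bitVec_rowComb, sub_self]
  have hne : ∀ z < 16, z ≠ 0 → bitVec z ≠ 0 := fun z hz hz0 h =>
    hz0 (bitVec_injOn z hz 0 (by norm_num) (h.trans (by funext i; simp [bitVec])))
  have hli : LinearIndependent (ZMod 2) ![bitVec x, bitVec y] :=
    linearIndependent_pair_zmod_two (hne x hx (by omega)) (hne y (by omega) hy0)
      fun h => hyx.ne' (bitVec_injOn x hx y (by omega) h)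
  refine ⟨brWord (A 0) + brWord (bitVec (brDiv x (rowComb a b c x))),
    add_mem (mem_byrneRavagnaniCode.2 ⟨_, rfl⟩) (mem_byrneRavagnaniCode.2 ⟨_, rfl⟩), ?_⟩
  rw [← sub_sub, ← hB]
  have := rank_add_two_le hli (hker x hx (by omega) rfl) (hker y (by omega) hy0 hxy.symm)
  omega

/-- A matrix whose coset of the code contains no matrix of rank one. -/
def brExtra : Matrix (Fin 4) (Fin 4) (ZMod 2) :=
  !![0, 0, 0, 0; 0, 1, 0, 0; 1, 0, 0, 0; 0, 0, 0, 0]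

lemma two_le_rank_brExtra_add (t : Fin 4 → ZMod 2) : 2 ≤ (brExtra + brWord t).rank := by
  have h : ∀ t : Fin 4 → ZMod 2, ∃ x y : Fin 4 → ZMod 2,
      Matrix.vecMul x (brExtra + brWord t) ≠ 0 ∧ Matrix.vecMul y (brExtra + brWord t) ≠ 0 ∧
        Matrix.vecMul x (brExtra + brWord t) ≠ Matrix.vecMul y (brExtra + brWord t) := by
    decide +kernel
  obtain ⟨x, y, hx, hy, hxy⟩ := h t
  exact two_le_rank (linearIndependent_pair_zmod_two hx hy hxy)

lemma brExtra_notMem : brExtra ∉ byrneRavagnaniCode := by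
  rw [mem_byrneRavagnaniCode]
  decide +kernel

lemma codeDistance_byrneRavagnaniCode_five : codeDistance byrneRavagnaniCode 5 = 2 := by
  rw [codeDistance, if_neg (by rw [finrank_byrneRavagnaniCode]; norm_num)]
  have hupper : ∀ D : Code (ZMod 2) 4 4, byrneRavagnaniCode ≤ D → finrank (ZMod 2) D = 5 →
      minDist D ≤ 2 := by
    intro D hD hdim
    have hlt : byrneRavagnaniCode < D := lt_of_le_of_ne hD (by
      rintro rfl
      rw [finrank_byrneRavagnaniCode] at hdim
      omega)
    obtain ⟨A, hA, hA'⟩ := SetLike.exists_of_lt hlt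
    obtain ⟨M, hM, hr⟩ := exists_rank_sub_le_two A
    refine (minDist_le_rank (D.sub_mem hA (hD hM)) ?_).trans hr
    rw [sub_ne_zero]
    rintro rfl
    exact hA' hM
  refine IsGreatest.csSup_eq ⟨?_, ?_⟩
  · have hdim : finrank (ZMod 2)
        (byrneRavagnaniCode ⊔ Submodule.span (ZMod 2) {brExtra} : Code (ZMod 2) 4 4) = 5 := by
      rw [Submodule.finrank_sup_span_singleton brExtra_notMem, finrank_byrneRavagnaniCode]
    refine ⟨_, le_sup_left, hdim, le_antisymm (hupper _ le_sup_left hdim) ?_⟩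
    refine le_minDist (ne_bot_of_finrank_pos (by omega)) fun M hM h0 => ?_
    obtain ⟨N, hN, E, hE, rfl⟩ := Submodule.mem_sup.1 hM
    obtain ⟨s, rfl⟩ := Submodule.mem_span_singleton.1 hE
    have h2 : ∀ s : ZMod 2, s = 0 ∨ s = 1 := by decide
    rcases h2 s with rfl | rfl
    · rw [zero_smul, add_zero] at h0 ⊢
      rw [rank_of_mem_byrneRavagnaniCode hN h0]
      norm_num
    · obtain ⟨t, rfl⟩ := mem_byrneRavagnaniCode.1 hN
      rw [one_smul, add_comm]
      exact two_le_rank_brExtra_add t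
  · rintro _ ⟨D, hD, hdim, rfl⟩
    exact hupper D hD hdim

/-! ### Comparison of the two codes -/

lemma exists_isGabidulin_four : ∃ C : Code (ZMod 2) 4 4, IsGabidulin C ∧
    finrank (ZMod 2) C = 4 ∧ minDist C = 4 := by
  let L := GaloisField 2 4
  let b : Basis (Fin 4) (ZMod 2) L :=
    Module.finBasisOfFinrankEq (ZMod 2) L (GaloisField.finrank 2 (by norm_num))
  exact ⟨gabidulinCode b b 1,
    ⟨L, inferInstance, inferInstance, b, b, 1, b.linearIndependent, le_rfl, by norm_num, le_rfl,
      rfl⟩,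
    finrank_gabidulinCode b b.linearIndependent (by norm_num),
    minDist_gabidulinCode b b.linearIndependent (k := 0) (by norm_num) (by norm_num)⟩

lemma codeDistance_eq_three_of_isGabidulin {C : Code (ZMod 2) 4 4} (hC : IsGabidulin C)
    (hdim : finrank (ZMod 2) C = 4) {i : ℕ} (h5 : 5 ≤ i) (h8 : i ≤ 8) : codeDistance C i = 3 := by
  obtain ⟨L, _, _, b, a, k, ha, -, hk, -, rfl⟩ := hC
  change finrank (ZMod 2) (gabidulinCode b a k) = 4 at hdim
  have h := finrank_gabidulinCode b ha hk
  obtain rfl : k = 1 := by omega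
  exact codeDistance_gabidulinCode b ha (by norm_num) (by omega) (by omega)

end RankMetric

theorem mainTheorem2 :
    (¬ RankMetric.IsQPolymatroidInvariant
        (RankMetric.codeDistances : RankMetric.Code (ZMod 2) 4 4 → Fin (4 * 4) → ℕ)) ∧
    (¬ RankMetric.IsQMatroidInvariant
        (RankMetric.codeDistances : RankMetric.Code (ZMod 2) 4 4 → Fin (4 * 4) → ℕ)) ∧
    RankMetric.IsMRD RankMetric.byrneRavagnaniCode ∧
    Module.finrank (ZMod 2) RankMetric.byrneRavagnaniCode = 4 ∧
    RankMetric.minDist RankMetric.byrneRavagnaniCode = 4 ∧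
    RankMetric.codeDistance RankMetric.byrneRavagnaniCode 5 = 2 ∧
    RankMetric.rowQPolymatroid RankMetric.byrneRavagnaniCode
      = RankMetric.uniformQMatroid (ZMod 2) 4 1 ∧
    RankMetric.colQPolymatroid RankMetric.byrneRavagnaniCode
      = RankMetric.uniformQMatroid (ZMod 2) 4 1 ∧
    (∃ C : RankMetric.Code (ZMod 2) 4 4, RankMetric.IsGabidulin C ∧
      Module.finrank (ZMod 2) C = Module.finrank (ZMod 2) RankMetric.byrneRavagnaniCode ∧
      RankMetric.minDist C = RankMetric.minDist RankMetric.byrneRavagnaniCode) ∧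
    (∀ C : RankMetric.Code (ZMod 2) 4 4, RankMetric.IsGabidulin C →
      Module.finrank (ZMod 2) C = Module.finrank (ZMod 2) RankMetric.byrneRavagnaniCode →
      RankMetric.minDist C = RankMetric.minDist RankMetric.byrneRavagnaniCode →
      RankMetric.IsMRD C ∧
      (∀ i : ℕ, 5 ≤ i → i ≤ 8 → RankMetric.codeDistance C i = 3) ∧
      RankMetric.rowQPolymatroid C = RankMetric.uniformQMatroid (ZMod 2) 4 1 ∧
      RankMetric.colQPolymatroid C = RankMetric.uniformQMatroid (ZMod 2) 4 1) := by
  have hdim := RankMetric.finrank_byrneRavagnaniCode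
  have hd := RankMetric.minDist_byrneRavagnaniCode
  have hrow := fun (C : RankMetric.Code (ZMod 2) 4 4) (h : Module.finrank (ZMod 2) C = 4)
    (h' : RankMetric.minDist C = 4) => RankMetric.rowQPolymatroid_eq_uniform (by norm_num) h
      fun _ => RankMetric.rank_eq_of_minDist_eq h'
  have hcol := fun (C : RankMetric.Code (ZMod 2) 4 4) (h : Module.finrank (ZMod 2) C = 4)
    (h' : RankMetric.minDist C = 4) => RankMetric.colQPolymatroid_eq_uniform (by norm_num) h
      fun _ => RankMetric.rank_eq_of_minDist_eq h'
  have h5 := RankMetric.codeDistance_byrneRavagnaniCode_five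
  obtain ⟨G, hG, hGdim, hGd⟩ := RankMetric.exists_isGabidulin_four
  have hne : RankMetric.codeDistances RankMetric.byrneRavagnaniCode
      ≠ RankMetric.codeDistances G := by
    intro h
    -- the index `4` of `Fin 16` stands for the fifth code distance
    have h : RankMetric.codeDistance RankMetric.byrneRavagnaniCode 5
      = RankMetric.codeDistance G 5 := congrFun h 4
    rw [h5, RankMetric.codeDistance_eq_three_of_isGabidulin hG hGdim le_rfl (by norm_num)] at h
    omega
  have hrow' := (hrow _ hdim hd).trans (hrow G hGdim hGd).symm
  have hcol' := (hcol _ hdim hd).trans (hcol G hGdim hGd).symm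
  refine ⟨fun h => hne (h _ _ hrow' hcol'), fun h => hne (h _ _ ?_ ?_ hrow' hcol'),
    RankMetric.isMRD_of_minDist_eq (by norm_num) hdim hd, hdim, hd, h5, hrow _ hdim hd,
    hcol _ hdim hd, ⟨G, hG, hGdim.trans hdim.symm, hGd.trans hd.symm⟩, fun C hC hCdim hCd => ?_⟩
  · rw [hrow _ hdim hd]
    exact RankMetric.isQMatroid_uniform 1
  · rw [hcol _ hdim hd]
    exact RankMetric.isQMatroid_uniform 1
  · rw [hdim] at hCdim
    rw [hd] at hCd
    exact ⟨RankMetric.isMRD_of_minDist_eq (by norm_num) hCdim hCd,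
      fun i hi hi' => RankMetric.codeDistance_eq_three_of_isGabidulin hC hCdim hi hi',
      hrow C hCdim hCd, hcol C hCdim hCd⟩
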